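/- Let $\mathcal H,\mathcal K$ be finite-dimensional complex Hilbert spaces, $\mathbf S$ a finite set and $\mathfrak I=\{\mathcal N_s\}_{s\in\mathbf S}$ a family of completely positive trace preserving maps $\mathcal N_s:\mathcal B(\mathcal H)\to\mathcal B(\mathcal K)$ (a finite arbitrarily varying quantum channel). For $l\in\mathbb N=\{1,2,\dots\}$ and $s^l=(s_1,\dots,s_l)\in\mathbf S^l$ put $\mathcal N_{s^l}:=\mathcal N_{s_1}\otimes\cdots\otimes\mathcal N_{s_l}$, and let $\mathcal S(\mathcal H^{\otimes l})$ be the set of positive semi-definite operators of trace one on $\mathcal H^{\otimes l}$. An $(l,M)$-code ($M\ge 1$) is a family $(\rho_i,D_i)_{i=1}^{M}$ of states $\rho_i\in\mathcal S(\mathcal H^{\otimes l})$ and positive semi-definite operators $D_i\in\mathcal B(\mathcal K^{\otimes l})$ with $\sum_{i=1}^M D_i=\mathbf 1$; its worst-case maximal error probability is $\sup_{s^l\in\mathbf S^l}\max_{1\le i\le M}\bigl(1-\mathrm{tr}(\mathcal N_{s^l}(\rho_i)D_i)\bigr)$. A number $R\ge 0$ is achievable if there is a sequence of $(l,M_l)$-codes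 with $\liminf_{l\to\infty}\frac1l\log_2 M_l\ge R$ whose worst-case maximal error probabilities tend to $0$ as $l\to\infty$. The classical deterministic maximal error capacity $C_{\det,\max}(\mathfrak I)\in[0,\infty]$ is the supremum of all achievable $R$. Then $C_{\det,\max}(\mathfrak I)=0$ if and only if for every $l\in\mathbb N$ and all $\rho_1,\rho_2\in\mathcal S(\mathcal H^{\otimes l})$ $$\mathrm{conv}\bigl(\{\mathcal N_{s^l}(\rho_1)\}_{s^l\in\mathbf S^l}\bigr)\cap\mathrm{conv}\bigl(\{\mathcal N_{s^l}(\rho_2)\}_{s^l\in\mathbf S^l}\bigr)\neq\emptyset .$$ -/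

import Mathlib

open Filter Topology
open scoped NNReal ENNReal ComplexOrder MatrixOrder Matrix.Norms.L2Operator CStarAlgebra

/-! Finite-dimensional Hilbert spaces are coordinatised by finite index types: `ℋ = ℂ^a`, so that
`ℬ(ℋ) = Matrix a a ℂ`, and `ℋ^{⊗ l}` has the product orthonormal basis indexed by `Fin l → a`. -/

namespace AVQC

/-- A completely positive, trace preserving map `ℬ(ℂ^a) → ℬ(ℂ^b)`. -/
structure Channel (a b : Type*) [Fintype a] [DecidableEq a] [Fintype b] [DecidableEq b]
    extends Matrix a a ℂ →CP Matrix b b ℂ where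
  trace_map : ∀ X : Matrix a a ℂ, (toFun X).trace = X.trace

/-- The tensor product `A₁ ⊗ ⋯ ⊗ A_l` of operators, as an operator on `(ℂ^n)^{⊗ l}`. -/
def tensorOp {n : Type*} {l : ℕ} (A : Fin l → Matrix n n ℂ) :
    Matrix (Fin l → n) (Fin l → n) ℂ :=
  Matrix.of fun k k' => ∏ j, A j (k j) (k' j)

/-- The tensor product `Φ₁ ⊗ ⋯ ⊗ Φ_l` of linear maps between operator spaces: the linear map with
`E_{i₁ i'₁} ⊗ ⋯ ⊗ E_{i_l i'_l} ↦ Φ₁(E_{i₁ i'₁}) ⊗ ⋯ ⊗ Φ_l(E_{i_l i'_l})` on matrix units. -/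
noncomputable def tensorMap {a b : Type*} [Fintype a] [DecidableEq a] {l : ℕ}
    (Φ : Fin l → (Matrix a a ℂ →ₗ[ℂ] Matrix b b ℂ)) :
    Matrix (Fin l → a) (Fin l → a) ℂ →ₗ[ℂ] Matrix (Fin l → b) (Fin l → b) ℂ where
  toFun X := ∑ i, ∑ i', X i i' • tensorOp fun j => Φ j (Matrix.single (i j) (i' j) 1)
  map_add' X Y := by simp [add_smul, Finset.sum_add_distrib]
  map_smul' c X := by simp [mul_smul, Finset.smul_sum]

/-- `(Φ₁ ⊗ ⋯ ⊗ Φ_l)(A₁ ⊗ ⋯ ⊗ A_l) = Φ₁(A₁) ⊗ ⋯ ⊗ Φ_l(A_l)`. -/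
theorem tensorMap_tensorOp {a b : Type*} [Fintype a] [DecidableEq a] {l : ℕ}
    (Φ : Fin l → (Matrix a a ℂ →ₗ[ℂ] Matrix b b ℂ)) (A : Fin l → Matrix a a ℂ) :
    tensorMap Φ (tensorOp A) = tensorOp fun j => Φ j (A j) := by
  have h : ∀ j k k', (Φ j (A j)) k k' =
      ∑ p : a × a, A j p.1 p.2 * (Φ j (Matrix.single p.1 p.2 1)) k k' := by
    intro j k k'
    conv_lhs => rw [Matrix.matrix_eq_sum_single (A j)]
    rw [Fintype.sum_prod_type]
    simp only [map_sum, Matrix.sum_apply]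
    refine Finset.sum_congr rfl fun i _ => Finset.sum_congr rfl fun i' _ => ?_
    have : Matrix.single i i' (A j i i') = A j i i' • Matrix.single i i' (1 : ℂ) := by
      simp
    rw [this, map_smul, Matrix.smul_apply, smul_eq_mul]
  ext k k'
  simp only [tensorMap, tensorOp, LinearMap.coe_mk, AddHom.coe_mk, Matrix.sum_apply,
    Matrix.smul_apply, Matrix.of_apply, smul_eq_mul, h]
  rw [Finset.prod_univ_sum, Fintype.piFinset_univ,
    ← (Equiv.arrowProdEquivProdArrow (Fin l) (fun _ => a) (fun _ => a)).symm.sum_comp,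
    Fintype.sum_prod_type]
  simp [Equiv.arrowProdEquivProdArrow, Finset.prod_mul_distrib]

section

variable {a b S : Type*} [Fintype a] [DecidableEq a] [Fintype b] [DecidableEq b]

/-- `𝒩_{s^l} = 𝒩_{s₁} ⊗ ⋯ ⊗ 𝒩_{s_l}`. -/
noncomputable def blockMap (N : S → Channel a b) {l : ℕ} (s : Fin l → S) :
    Matrix (Fin l → a) (Fin l → a) ℂ →ₗ[ℂ] Matrix (Fin l → b) (Fin l → b) ℂ :=
  tensorMap fun j => (N (s j)).toLinearMap

/-- States: positive semidefinite operators of trace one. -/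
def IsState {n : Type*} [Fintype n] (ρ : Matrix n n ℂ) : Prop :=
  ρ.PosSemidef ∧ ρ.trace = 1

/-- An `(l, M)`-code for message transmission from `ℋ^{⊗ l}` to `𝒦^{⊗ l}`, where `ℋ = ℂ^a` and
`𝒦 = ℂ^b`. -/
structure MessageCode (a b : Type*) [Fintype a] [Fintype b] [DecidableEq b] (l M : ℕ) where
  state : Fin M → Matrix (Fin l → a) (Fin l → a) ℂ
  isState_state : ∀ i, IsState (state i)
  effect : Fin M → Matrix (Fin l → b) (Fin l → b) ℂ
  posSemidef_effect : ∀ i, (effect i).PosSemidef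
  sum_effect : ∑ i, effect i = 1

/-- `P_e(ℭ, s^l) = max_i (1 - tr (𝒩_{s^l}(ρ_i) D_i))`; these traces are real numbers. -/
noncomputable def MessageCode.errorAt {l M : ℕ} (C : MessageCode a b l M)
    (N : S → Channel a b) (s : Fin l → S) : ℝ :=
  ⨆ i : Fin M, (1 - (blockMap N s (C.state i) * C.effect i).trace.re)

/-- The worst-case maximal probability of error `sup_{s^l} P_e(ℭ, s^l)`. -/
noncomputable def MessageCode.maxError {l M : ℕ} (C : MessageCode a b l M)
    (N : S → Channel a b) : ℝ :=
  ⨆ s : Fin l → S, C.errorAt N s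

/-- `R ≥ 0` is achievable with deterministic codes and asymptotically vanishing maximal error: there
are `(l, M_l)`-codes with `liminf (1/l) log₂ M_l ≥ R` whose worst-case maximal error tends to `0`.
The limit inferior is taken in the extended reals. -/
def IsAchievableRate (N : S → Channel a b) (R : ℝ≥0) : Prop :=
  ∃ (M : ℕ → ℕ) (C : ∀ l, MessageCode a b l (M l)),
    (∀ l, 0 < M l) ∧
    (((R : ℝ) : EReal) ≤
      liminf (fun l : ℕ => (((1 / (l : ℝ)) * Real.logb 2 (M l) : ℝ) : EReal)) atTop) ∧
    Tendsto (fun l => (C l).maxError N) atTop (𝓝 0)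

/-- The classical deterministic maximal error capacity: the supremum of the achievable rates. -/
noncomputable def detMaxCapacity (N : S → Channel a b) : ℝ≥0∞ :=
  ⨆ (R : ℝ≥0) (_ : IsAchievableRate N R), (R : ℝ≥0∞)

end

end AVQC

/-!
The capacity vanishes exactly when any two states, at any block length, can be made
indistinguishable by a randomised choice of the channel sequence.

If the convex hulls of outputs of any two states meet, no code with two messages has worst-case
error below `1 / 2` (`AVQC.MessageCode.half_le_maxError`): the probability of decoding a given
message is an affine function of the output state, so a common point of the two hulls would be
decoded as either message with the success probability guaranteed for it, while these two
probabilities add up to at most one. A positive rate needs at least two messages.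

Conversely, suppose that the hulls are disjoint for two states `ρ₁`, `ρ₂` of block length `l`. They
are compact and convex, so a Hermitian operator separates them, and after rescaling it is an effect
`A` with `tr (𝒩_s(ρ₁) A) ≥ c + δ` and `tr (𝒩_s(ρ₂) A) ≤ c - δ` for all `s`
(`AVQC.exists_effect_of_disjoint_convexHull`). Sending `ρ₁` or `ρ₂` and measuring `A` in every block
yields a binary arbitrarily varying channel whose output bit is always biased towards the input bit,
relative to the threshold `c`. Decode by maximising the correlation between the signs of a codeword
and the deviations of the received bits from `c`. Positions where two codewords agree cancel in the
difference of their scores, and on the other positions the transmitted word gains at least `2 δ` on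
average, whatever the adversary does; a Chernoff bound makes the probability of confusion
exponentially small in the Hamming distance (`AVQC.sum_score_le_score_le`, `AVQC.exists_decoder`).
Binary codes with exponentially many words and linear minimum distance exist by the
Gilbert–Varshamov argument (`AVQC.exists_binary_code`), and a union bound over a sufficiently small
exponential number of codewords gives a positive achievable rate
(`AVQC.exists_isAchievableRate_pos`).

That output probabilities are nonnegative requires tensor products of completely positive maps to be
positive, which is read off from Kraus operators (`AVQC.exists_kraus`, `AVQC.posSemidef_blockMap`).
-/

namespace AVQC

/-! ### Tensor products of operators -/

section TensorOp

variable {n : Type*} {l : ℕ}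

theorem tensorOp_mul [Fintype n] (A B : Fin l → Matrix n n ℂ) :
    tensorOp A * tensorOp B = tensorOp fun j => A j * B j := by
  ext k k'
  simp only [tensorOp, Matrix.mul_apply, Matrix.of_apply, Finset.prod_univ_sum,
    Fintype.piFinset_univ, Finset.prod_mul_distrib]

theorem conjTranspose_tensorOp (A : Fin l → Matrix n n ℂ) :
    (tensorOp A).conjTranspose = tensorOp fun j => (A j).conjTranspose := by
  ext k k'
  simp [tensorOp, Matrix.conjTranspose_apply]

theorem tensorOp_one [DecidableEq n] : tensorOp (fun _ : Fin l => (1 : Matrix n n ℂ)) = 1 := by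
  ext k k'
  simp only [tensorOp, Matrix.of_apply, Matrix.one_apply, Finset.prod_ite_zero, funext_iff]
  simp

theorem trace_tensorOp [Fintype n] (A : Fin l → Matrix n n ℂ) :
    (tensorOp A).trace = ∏ j, (A j).trace := by
  simp only [tensorOp, Matrix.trace, Matrix.diag_apply, Matrix.of_apply, Finset.prod_univ_sum,
    Fintype.piFinset_univ]

theorem posSemidef_tensorOp [Fintype n] {A : Fin l → Matrix n n ℂ} (hA : ∀ j, (A j).PosSemidef) :
    (tensorOp A).PosSemidef := by
  classical
  have h : ∀ j, ∃ B : Matrix n n ℂ, A j = B.conjTranspose * B := fun j => by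
    obtain ⟨B, hB⟩ := CStarAlgebra.nonneg_iff_eq_star_mul_self.mp (hA j).nonneg
    exact ⟨B, hB⟩
  choose B hB using h
  have : tensorOp A = (tensorOp B).conjTranspose * tensorOp B := by
    rw [conjTranspose_tensorOp, tensorOp_mul]
    exact congrArg _ (funext hB)
  rw [this]
  exact Matrix.posSemidef_conjTranspose_mul_self _

theorem sum_tensorOp {κ : Type*} [Fintype κ] (A : κ → Matrix n n ℂ) :
    ∑ y : Fin l → κ, tensorOp (fun j => A (y j)) = tensorOp fun _ => ∑ c, A c := by
  ext k k'
  simp only [tensorOp, Matrix.sum_apply, Matrix.of_apply, Finset.prod_univ_sum,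
    Fintype.piFinset_univ]

end TensorOp

theorem trace_mul_nonneg {n : Type*} [Fintype n] {A B : Matrix n n ℂ}
    (hA : A.PosSemidef) (hB : B.PosSemidef) : 0 ≤ (A * B).trace := by
  classical
  obtain ⟨C, rfl⟩ := CStarAlgebra.nonneg_iff_eq_star_mul_self.mp hB.nonneg
  have h : (A * (star C * C)).trace = (C * A * C.conjTranspose).trace := by
    rw [← mul_assoc, Matrix.trace_mul_comm, ← mul_assoc]
    rfl
  rw [h]
  exact (hA.mul_mul_conjTranspose_same C).trace_nonneg

/-! ### Kraus operators and positivity of tensor products of channels -/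

theorem tensorMap_apply {a b : Type*} [Fintype a] [DecidableEq a] {l : ℕ}
    (Φ : Fin l → (Matrix a a ℂ →ₗ[ℂ] Matrix b b ℂ))
    (X : Matrix (Fin l → a) (Fin l → a) ℂ) (k k' : Fin l → b) :
    tensorMap Φ X k k' =
      ∑ i, ∑ i', X i i' * ∏ j, Φ j (Matrix.single (i j) (i' j) 1) (k j) (k' j) := by
  simp [tensorMap, tensorOp, Matrix.sum_apply]

section Channel

variable {a b S : Type*} [Fintype a] [DecidableEq a] [Fintype b] [DecidableEq b]

/-- `CStarAlgebra.nonneg_iff_eq_star_mul_self` for an abstract C⋆-algebra. Its instance arguments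
are found here but not for `CStarMatrix`, to which this lemma can then be applied by unification. -/
theorem exists_eq_star_mul_self_of_nonneg {A : Type*} [NonUnitalCStarAlgebra A] [PartialOrder A]
    [StarOrderedRing A] {x : A} (hx : 0 ≤ x) : ∃ y, x = star y * y :=
  CStarAlgebra.nonneg_iff_eq_star_mul_self.mp hx

/-- A completely positive map has Kraus operators: apply complete positivity to the block matrix
`[E_{ii'}]`, which is positive because `E_{i₀ i}* E_{i₀ i'} = E_{i i'}`. -/
theorem exists_kraus (Φ : Matrix a a ℂ →CP Matrix b b ℂ) :
    ∃ K : a × b → Matrix a b ℂ, ∀ i i' k k',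
      Φ (Matrix.single i i' 1) k k' = ∑ μ, star (K μ i k) * K μ i' k' := by
  rcases isEmpty_or_nonempty a with ha | ⟨⟨i₀⟩⟩
  · exact ⟨fun _ => 0, fun i => ha.elim i⟩
  -- Only the row `i₀` of `x` is nonzero; it lists the matrix units `E_{i₀ i}`.
  set x : CStarMatrix a a (Matrix a a ℂ) :=
    CStarMatrix.ofMatrix (Matrix.of fun p i => if p = i₀ then Matrix.single i₀ i 1 else 0) with hx
  have hpos : (0 : CStarMatrix a a (Matrix a a ℂ)) ≤ star x * x := star_mul_self_nonneg x
  have hmap := CompletelyPositiveMap.map_cstarMatrix_nonneg Φ _ hpos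
  obtain ⟨y, hy⟩ := exists_eq_star_mul_self_of_nonneg hmap
  refine ⟨fun μ => Matrix.of fun i k => y μ.1 i μ.2 k, fun i i' k k' => ?_⟩
  have h1 : (star x * x) i i' = Matrix.single i i' 1 := by
    rw [CStarMatrix.mul_apply]
    simp [hx, CStarMatrix.star_apply, Matrix.star_eq_conjTranspose, apply_ite, ite_mul]
  have h2 := congrFun (congrFun hy i) i'
  rw [CStarMatrix.map_apply, h1, CStarMatrix.mul_apply] at h2
  rw [h2, Matrix.sum_apply, Fintype.sum_prod_type]
  refine Finset.sum_congr rfl fun p _ => ?_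
  rw [Matrix.mul_apply]
  rfl

/-- Block channels are positive maps: tensor products of Kraus operators are Kraus operators of the
tensor product. -/
theorem posSemidef_blockMap (N : S → Channel a b) {l : ℕ} (s : Fin l → S)
    {X : Matrix (Fin l → a) (Fin l → a) ℂ} (hX : X.PosSemidef) :
    (blockMap N s X).PosSemidef := by
  choose K hK using fun t => exists_kraus (N t).toCompletelyPositiveMap
  let L : (Fin l → a × b) → Matrix (Fin l → a) (Fin l → b) ℂ := fun μ =>
    Matrix.of fun i k => ∏ j, K (s j) (μ j) (i j) (k j)
  have h : blockMap N s X = ∑ μ, (L μ).conjTranspose * X * L μ := by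
    ext k k'
    have hprod : ∀ i i' : Fin l → a,
        ∏ j, (N (s j)).toLinearMap (Matrix.single (i j) (i' j) 1) (k j) (k' j) =
          ∑ μ : Fin l → a × b, star (L μ i k) * L μ i' k' := by
      intro i i'
      have : ∀ j, (N (s j)).toLinearMap (Matrix.single (i j) (i' j) 1) (k j) (k' j) =
          ∑ μ, star (K (s j) μ (i j) (k j)) * K (s j) μ (i' j) (k' j) := fun j => hK _ _ _ _ _
      simp only [this, Finset.prod_univ_sum, Fintype.piFinset_univ, Finset.prod_mul_distrib, L,
        Matrix.of_apply, star_prod]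
    rw [blockMap, tensorMap_apply]
    simp only [hprod, Matrix.sum_apply, Matrix.mul_apply, Matrix.conjTranspose_apply,
      Finset.mul_sum, Finset.sum_mul]
    rw [Finset.sum_comm]
    refine (Finset.sum_congr rfl fun i' _ => Finset.sum_comm).trans ?_
    rw [Finset.sum_comm]
    refine Finset.sum_congr rfl fun μ _ => Finset.sum_congr rfl fun i' _ =>
      Finset.sum_congr rfl fun i _ => ?_
    ring
  rw [h]
  exact Matrix.posSemidef_sum _ fun μ _ => hX.conjTranspose_mul_mul_same _

theorem trace_blockMap (N : S → Channel a b) {l : ℕ} (s : Fin l → S)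
    (X : Matrix (Fin l → a) (Fin l → a) ℂ) : (blockMap N s X).trace = X.trace := by
  have h : ∀ i i' : Fin l → a,
      (tensorOp fun j => (N (s j)).toLinearMap (Matrix.single (i j) (i' j) 1)).trace =
        if i = i' then 1 else 0 := by
    intro i i'
    rw [trace_tensorOp]
    have : ∀ j, ((N (s j)).toLinearMap (Matrix.single (i j) (i' j) 1)).trace =
        if i j = i' j then 1 else 0 := fun j => by
      rw [show ((N (s j)).toLinearMap (Matrix.single (i j) (i' j) 1)).trace = _ from
        (N (s j)).trace_map _]
      split_ifs with hij
      · rw [hij, Matrix.trace_single_eq_same]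
      · exact Matrix.trace_single_eq_of_ne _ _ _ hij
    simp only [this, Finset.prod_ite_zero, funext_iff]
    simp
  simp only [blockMap, tensorMap, LinearMap.coe_mk, AddHom.coe_mk, Matrix.trace_sum,
    Matrix.trace_smul, h, smul_eq_mul, mul_ite, mul_one, mul_zero, Finset.sum_ite_eq,
    Finset.mem_univ, if_true]
  rfl

theorem isState_blockMap (N : S → Channel a b) {l : ℕ} (s : Fin l → S)
    {X : Matrix (Fin l → a) (Fin l → a) ℂ} (hX : IsState X) : IsState (blockMap N s X) :=
  ⟨posSemidef_blockMap N s hX.1, (trace_blockMap N s X).trans hX.2⟩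

end Channel

/-! ### Block operators -/

section Block

open scoped Kronecker

variable {a b S : Type*} {n l r m : ℕ}

/-- The decomposition of an index of `(ℂ^a)^{⊗ m}` into `n` blocks of length `l` and a remainder of
length `r`, according to a partition `σ` of the `m` tensor positions. -/
def blockEquiv (a : Type*) (σ : (Fin n × Fin l) ⊕ Fin r ≃ Fin m) :
    (Fin m → a) ≃ (Fin n → Fin l → a) × (Fin r → a) :=
  (σ.symm.arrowCongr (Equiv.refl a)).trans <|
    (Equiv.sumArrowEquivProdArrow _ _ _).trans <|
      (Equiv.curry _ _ _).prodCongr (Equiv.refl _)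

/-- The operator on `(ℂ^a)^{⊗ m}` acting as `P₁ ⊗ ⋯ ⊗ P_n ⊗ Q`, where each `P x` occupies one block
of `l` tensor positions and `Q` the remaining `r` positions. -/
def blockOp (σ : (Fin n × Fin l) ⊕ Fin r ≃ Fin m)
    (P : Fin n → Matrix (Fin l → a) (Fin l → a) ℂ) (Q : Matrix (Fin r → a) (Fin r → a) ℂ) :
    Matrix (Fin m → a) (Fin m → a) ℂ :=
  (tensorOp P ⊗ₖ Q).submatrix (blockEquiv a σ) (blockEquiv a σ)

variable (σ : (Fin n × Fin l) ⊕ Fin r ≃ Fin m)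

theorem blockOp_mul [Fintype a] (P P' : Fin n → Matrix (Fin l → a) (Fin l → a) ℂ)
    (Q Q' : Matrix (Fin r → a) (Fin r → a) ℂ) :
    blockOp σ P Q * blockOp σ P' Q' = blockOp σ (fun x => P x * P' x) (Q * Q') := by
  classical
  rw [blockOp, blockOp, Matrix.submatrix_mul_equiv, ← Matrix.mul_kronecker_mul, tensorOp_mul]
  rfl

theorem trace_blockOp [Fintype a] (P : Fin n → Matrix (Fin l → a) (Fin l → a) ℂ)
    (Q : Matrix (Fin r → a) (Fin r → a) ℂ) :
    (blockOp σ P Q).trace = (∏ x, (P x).trace) * Q.trace := by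
  rw [← trace_tensorOp, ← Matrix.trace_kronecker]
  exact (blockEquiv a σ).sum_comp fun p => (tensorOp P ⊗ₖ Q) p p

theorem posSemidef_blockOp [Fintype a] {P : Fin n → Matrix (Fin l → a) (Fin l → a) ℂ}
    {Q : Matrix (Fin r → a) (Fin r → a) ℂ} (hP : ∀ x, (P x).PosSemidef) (hQ : Q.PosSemidef) :
    (blockOp σ P Q).PosSemidef := by
  classical
  exact ((posSemidef_tensorOp hP).kronecker hQ).submatrix _

theorem isState_blockOp [Fintype a] {P : Fin n → Matrix (Fin l → a) (Fin l → a) ℂ}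
    {Q : Matrix (Fin r → a) (Fin r → a) ℂ} (hP : ∀ x, IsState (P x)) (hQ : IsState Q) :
    IsState (blockOp σ P Q) :=
  ⟨posSemidef_blockOp σ (fun x => (hP x).1) hQ.1, by simp [trace_blockOp, (hP _).2, hQ.2]⟩

theorem sum_blockOp {κ : Type*} [Fintype κ] [DecidableEq a]
    (A : κ → Matrix (Fin l → a) (Fin l → a) ℂ) (hA : ∑ c, A c = 1) :
    ∑ y : Fin n → κ, blockOp σ (fun x => A (y x)) (1 : Matrix (Fin r → a) (Fin r → a) ℂ) = 1 := by
  have h : ∑ y : Fin n → κ, blockOp σ (fun x => A (y x)) (1 : Matrix (Fin r → a) (Fin r → a) ℂ) =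
      ((∑ y : Fin n → κ, tensorOp fun x => A (y x)) ⊗ₖ
        (1 : Matrix (Fin r → a) (Fin r → a) ℂ)).submatrix (blockEquiv a σ) (blockEquiv a σ) := by
    ext k k'
    simp [blockOp, Matrix.sum_apply, Finset.sum_mul]
  rw [h, sum_tensorOp, hA, tensorOp_one, Matrix.one_kronecker_one, Matrix.submatrix_one_equiv]

/-- Block products of channels act blockwise on block products of operators. -/
theorem blockMap_blockOp [Fintype a] [DecidableEq a] [Fintype b] [DecidableEq b]
    (N : S → Channel a b) (s : Fin m → S) (P : Fin n → Matrix (Fin l → a) (Fin l → a) ℂ)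
    (Q : Matrix (Fin r → a) (Fin r → a) ℂ) :
    blockMap N s (blockOp σ P Q) =
      blockOp σ (fun x => blockMap N ((blockEquiv S σ s).1 x) (P x))
        (blockMap N (blockEquiv S σ s).2 Q) := by
  ext k k'
  set G : S → a → a → b → b → ℂ := fun t i i' k k' =>
    (N t).toLinearMap (Matrix.single i i' 1) k k' with hG
  have key : ∀ {l : ℕ} (s : Fin l → S) (X : Matrix (Fin l → a) (Fin l → a) ℂ) (k k' : Fin l → b),
      blockMap N s X k k' =
        ∑ p : (Fin l → a) × (Fin l → a), X p.1 p.2 * ∏ j, G (s j) (p.1 j) (p.2 j) (k j) (k' j) := by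
    intro l s X k k'
    rw [blockMap, tensorMap_apply, Fintype.sum_prod_type]
  have hsplit : ∀ p : (Fin m → a) × (Fin m → a),
      ∏ j, G (s j) (p.1 j) (p.2 j) (k j) (k' j) =
        (∏ x, ∏ j, G ((blockEquiv S σ s).1 x j) ((blockEquiv a σ p.1).1 x j)
          ((blockEquiv a σ p.2).1 x j) ((blockEquiv b σ k).1 x j) ((blockEquiv b σ k').1 x j)) *
        ∏ u, G ((blockEquiv S σ s).2 u) ((blockEquiv a σ p.1).2 u)
          ((blockEquiv a σ p.2).2 u) ((blockEquiv b σ k).2 u) ((blockEquiv b σ k').2 u) := by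
    intro p
    rw [← σ.prod_comp, Fintype.prod_sum_type, Fintype.prod_prod_type]
    rfl
  -- Pairs of indices, regrouped so that both indices of each block come together.
  let E : (Fin n → (Fin l → a) × (Fin l → a)) × ((Fin r → a) × (Fin r → a)) ≃
      (Fin m → a) × (Fin m → a) :=
    (((Equiv.arrowProdEquivProdArrow (Fin n) (fun _ => Fin l → a) (fun _ => Fin l → a)).prodCongr
      (Equiv.refl _)).trans (Equiv.prodProdProdComm _ _ _ _)).trans
      ((blockEquiv a σ).symm.prodCongr (blockEquiv a σ).symm)
  rw [key, ← E.sum_comp, Fintype.sum_prod_type]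
  simp only [hsplit]
  simp only [blockOp, Matrix.submatrix_apply, Matrix.kroneckerMap_apply, tensorOp, Matrix.of_apply,
    key, Finset.prod_univ_sum, Fintype.piFinset_univ]
  rw [Finset.sum_mul_sum]
  refine Finset.sum_congr rfl fun p _ => Finset.sum_congr rfl fun q _ => ?_
  have h1 : blockEquiv a σ (E (p, q)).1 = (fun x => (p x).1, q.1) := by
    simp [E, Equiv.arrowProdEquivProdArrow]
  have h2 : blockEquiv a σ (E (p, q)).2 = (fun x => (p x).2, q.2) := by
    simp [E, Equiv.arrowProdEquivProdArrow]
  rw [h1, h2, Finset.prod_mul_distrib]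
  ring

end Block

/-! ### Binary codes with linear minimum distance -/

/-- Volume bound for Hamming balls, from `∑ y, 2 ^ (-d(x, y)) = (3 / 2) ^ (5 * k)` and
`2 * (3 / 2) ^ 5 ≤ 16`. -/
theorem card_hammingBall_le (k : ℕ) (x : Fin (5 * k) → Bool) :
    (Finset.univ.filter fun y => hammingDist x y < k).card ≤ 16 ^ k := by
  have hsum : ∑ y : Fin (5 * k) → Bool, (1 / 2 : ℝ) ^ hammingDist x y = (3 / 2) ^ (5 * k) := by
    have h : ∀ y : Fin (5 * k) → Bool,
        (1 / 2 : ℝ) ^ hammingDist x y = ∏ j, if x j ≠ y j then 1 / 2 else 1 := by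
      intro y
      rw [Finset.prod_ite, Finset.prod_const, Finset.prod_const_one, mul_one, hammingDist]
    simp only [h]
    have hp := Finset.prod_univ_sum (fun _ : Fin (5 * k) => (Finset.univ : Finset Bool))
      (fun j c => if x j ≠ c then (1 / 2 : ℝ) else 1)
    rw [Fintype.piFinset_univ] at hp
    rw [← hp]
    have : ∀ j, ∑ c, (if x j ≠ c then (1 / 2 : ℝ) else 1) = 3 / 2 := by
      intro j
      cases x j <;> norm_num
    rw [Finset.prod_congr rfl fun j _ => this j, Finset.prod_const, Finset.card_univ,
      Fintype.card_fin]
  have hle : ((Finset.univ.filter fun y => hammingDist x y < k).card : ℝ) * (1 / 2) ^ k ≤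
      (3 / 2) ^ (5 * k) := by
    rw [← hsum, ← nsmul_eq_mul]
    refine (Finset.card_nsmul_le_sum _ (fun y => (1 / 2 : ℝ) ^ hammingDist x y) _
      fun y hy => ?_).trans
      (Finset.sum_le_sum_of_subset_of_nonneg (Finset.subset_univ _) fun _ _ _ => by positivity)
    exact pow_le_pow_of_le_one (by norm_num) (by norm_num) (Finset.mem_filter.1 hy).2.le
  have h16 : ((3 / 2 : ℝ)) ^ (5 * k) ≤ 16 ^ k * (1 / 2) ^ k := by
    rw [pow_mul, ← mul_pow]
    gcongr
    norm_num
  have := le_of_mul_le_mul_right (hle.trans h16) (by positivity)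
  exact_mod_cast this

/-- A Gilbert–Varshamov bound: greedily, a new codeword can be added as long as the balls around
the `M < 2 ^ k` words chosen so far do not cover the `32 ^ k` words. -/
theorem exists_finset_hammingDist_ge (k M : ℕ) (hM : M ≤ 2 ^ k) :
    ∃ C : Finset (Fin (5 * k) → Bool), C.card = M ∧
      (C : Set (Fin (5 * k) → Bool)).Pairwise fun x y => k ≤ hammingDist x y := by
  induction M with
  | zero => exact ⟨∅, by simp⟩
  | succ M ih =>
    obtain ⟨C, hC, hpair⟩ := ih (by omega)
    rcases k.eq_zero_or_pos with rfl | hk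
    · obtain rfl : M = 0 := by simpa using hM
      exact ⟨{fun _ => true}, by simp⟩
    obtain ⟨z, hz⟩ : ∃ z,
        z ∉ C.biUnion fun x => Finset.univ.filter fun y => hammingDist x y < k := by
      by_contra! hcov
      have h1 : (Finset.univ : Finset (Fin (5 * k) → Bool)).card ≤ M * 16 ^ k := by
        rw [← hC]
        exact (Finset.card_le_card fun z _ => hcov z).trans
          (Finset.card_biUnion_le_card_mul _ _ _ fun x _ => card_hammingBall_le k x)
      have h2 : (Finset.univ : Finset (Fin (5 * k) → Bool)).card = 2 ^ k * 16 ^ k := by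
        rw [Finset.card_univ, Fintype.card_fun, Fintype.card_bool, Fintype.card_fin, pow_mul,
          ← mul_pow]
        norm_num
      rw [h2] at h1
      have := Nat.le_of_mul_le_mul_right h1 (by positivity)
      omega
    have hz' : ∀ x ∈ C, k ≤ hammingDist x z := by
      intro x hx
      by_contra! hlt
      exact hz (Finset.mem_biUnion.2 ⟨x, hx, by simpa using hlt⟩)
    have hzC : z ∉ C := fun h => by
      have := hz' z h
      rw [hammingDist_self] at this
      omega
    refine ⟨insert z C, by rw [Finset.card_insert_of_notMem hzC, hC], ?_⟩
    rw [Finset.coe_insert]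
    refine hpair.insert fun x hx _ => ⟨?_, hz' x hx⟩
    rw [hammingDist_comm]
    exact hz' x hx

theorem exists_binary_code {k M : ℕ} (hM : M ≤ 2 ^ k) :
    ∃ X : Fin M → Fin (5 * k) → Bool, Pairwise fun i j => k ≤ hammingDist (X i) (X j) := by
  obtain ⟨C, hC, hpair⟩ := exists_finset_hammingDist_ge k M hM
  refine ⟨fun i => ((C.equivFinOfCardEq hC).symm i : Fin (5 * k) → Bool), fun i j hij => ?_⟩
  refine hpair (Subtype.coe_prop _) (Subtype.coe_prop _) fun h => hij ?_
  exact (C.equivFinOfCardEq hC).symm.injective (Subtype.ext h)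

/-! ### Maximum-score decoding of a binary arbitrarily varying channel -/

/-- The sign `±1` carried by a bit. -/
def bitSign (x : Bool) : ℝ := if x then 1 else -1

/-- The score of the codeword `x` against the received word `y`: the correlation of the signs of `x`
with the deviations of `y` from the threshold `c`. -/
noncomputable def score (c : ℝ) {n : ℕ} (x y : Fin n → Bool) : ℝ :=
  ∑ j, bitSign (x j) * ((if y j then 1 else 0) - c)

/-- One factor of the Chernoff bound: a variable `w` with `|w| ≤ 1` and mean at least `δ` satisfies
`𝔼 exp (-(δ / 2) w) ≤ 1 - δ ^ 2 / 4`. -/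
theorem expectation_exp_le {κ : Type*} [Fintype κ] {p w : κ → ℝ} {δ : ℝ} (hδ0 : 0 ≤ δ) (hδ1 : δ ≤ 1)
    (hp : ∀ i, 0 ≤ p i) (hp1 : ∑ i, p i = 1) (hw : ∀ i, |w i| ≤ 1) (hmean : δ ≤ ∑ i, p i * w i) :
    ∑ i, p i * Real.exp (-(δ / 2) * w i) ≤ 1 - δ ^ 2 / 4 := by
  have h : ∀ i, Real.exp (-(δ / 2) * w i) ≤ 1 - δ / 2 * w i + δ ^ 2 / 4 := by
    intro i
    have h1 : |-(δ / 2) * w i| ≤ 1 := by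
      rw [abs_mul, abs_neg, abs_of_nonneg (by positivity)]
      nlinarith [hw i, abs_nonneg (w i)]
    have h2 := (abs_le.1 (Real.abs_exp_sub_one_sub_id_le h1)).2
    have h3 : w i ^ 2 ≤ 1 := by
      rw [← sq_abs]
      nlinarith [hw i, abs_nonneg (w i)]
    nlinarith [mul_le_mul_of_nonneg_left h3 (sq_nonneg δ)]
  calc ∑ i, p i * Real.exp (-(δ / 2) * w i)
      ≤ ∑ i, p i * (1 - δ / 2 * w i + δ ^ 2 / 4) :=
        Finset.sum_le_sum fun i _ => mul_le_mul_of_nonneg_left (h i) (hp i)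
    _ = (∑ i, p i) * (1 + δ ^ 2 / 4) - δ / 2 * ∑ i, p i * w i := by
        rw [Finset.sum_mul, Finset.mul_sum, ← Finset.sum_sub_distrib]
        exact Finset.sum_congr rfl fun i _ => by ring
    _ ≤ 1 - δ ^ 2 / 4 := by
        rw [hp1]
        nlinarith

/-- If `x` is sent over memoryless binary channels that bias each output bit towards the input bit
by `δ` relative to the threshold `c`, a word `x'` outscores `x` with probability exponentially small
in the Hamming distance: only the positions where `x` and `x'` differ enter the difference of
scores, and each contributes positively on average. -/
theorem sum_score_le_score_le {n : ℕ} {c δ : ℝ} (hc0 : 0 ≤ c) (hc1 : c ≤ 1) (hδ0 : 0 ≤ δ)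
    (hδ1 : δ ≤ 1) (x x' : Fin n → Bool) {p : Fin n → Bool → ℝ} (hp : ∀ j t, 0 ≤ p j t)
    (hp1 : ∀ j, ∑ t, p j t = 1) (hmean : ∀ j, δ ≤ bitSign (x j) * (p j true - c)) :
    ∑ y : Fin n → Bool, (if score c x y ≤ score c x' y then ∏ j, p j (y j) else 0) ≤
      (1 - δ ^ 2 / 4) ^ hammingDist x x' := by
  set f : Fin n → Bool → ℝ := fun j t =>
    if x j ≠ x' j then Real.exp (-(δ / 2) * (bitSign (x j) * ((if t then 1 else 0) - c))) else 1
    with hf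
  have hprod : ∀ y : Fin n → Bool, ∏ j, f j (y j) =
      Real.exp (-(δ / 4) * (score c x y - score c x' y)) := by
    intro y
    rw [score, score, ← Finset.sum_sub_distrib, Finset.mul_sum, Real.exp_sum]
    refine Finset.prod_congr rfl fun j _ => ?_
    by_cases h : x j = x' j
    · simp [hf, h]
    · have hs : bitSign (x' j) = -bitSign (x j) := by
        revert h
        cases x j <;> cases x' j <;> simp [bitSign]
      simp only [hf, if_pos h, hs]
      congr 1
      ring
  calc ∑ y : Fin n → Bool, (if score c x y ≤ score c x' y then ∏ j, p j (y j) else 0)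
      ≤ ∑ y : Fin n → Bool, ∏ j, p j (y j) * f j (y j) := by
        refine Finset.sum_le_sum fun y _ => ?_
        have h0 : 0 ≤ ∏ j, p j (y j) := Finset.prod_nonneg fun j _ => hp j _
        rw [Finset.prod_mul_distrib, hprod]
        split_ifs with h
        · refine le_mul_of_one_le_right h0 (Real.one_le_exp ?_)
          nlinarith
        · positivity
    _ = ∏ j, ∑ t, p j t * f j t := by
        rw [Finset.prod_univ_sum, Fintype.piFinset_univ]
    _ ≤ ∏ j, if x j ≠ x' j then 1 - δ ^ 2 / 4 else 1 := by
        refine Finset.prod_le_prod (fun j _ => Finset.sum_nonneg fun t _ =>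
          mul_nonneg (hp j t) ?_) fun j _ => ?_
        · simp only [hf]
          split_ifs <;> positivity
        · by_cases h : x j = x' j
          · simp only [hf, h, ne_eq, not_true_eq_false, if_false, mul_one, hp1, le_refl]
          · simp only [hf, ne_eq, h, not_false_eq_true, if_true]
            refine expectation_exp_le hδ0 hδ1 (hp j) (hp1 j) (fun t => ?_) ?_
            · rw [abs_le]
              cases x j <;> cases t <;> simp [bitSign] <;> constructor <;> linarith
            · have h1 := hp1 j
              have h2 := hmean j
              rw [Fintype.sum_bool] at h1 ⊢
              simp only [if_true, Bool.false_eq_true, if_false]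
              calc δ ≤ _ := h2
                _ = bitSign (x j) * (p j true - c * (p j true + p j false)) := by rw [h1, mul_one]
                _ = _ := by ring
    _ = (1 - δ ^ 2 / 4) ^ hammingDist x x' := by
        rw [Finset.prod_ite, Finset.prod_const, Finset.prod_const_one, mul_one, hammingDist]

/-- Maximum-score decoding of a binary code of minimum distance `K` succeeds with high probability
for every message, whatever the sequence of channels. -/
theorem exists_decoder {n M K : ℕ} {c δ : ℝ} (hc0 : 0 ≤ c) (hc1 : c ≤ 1) (hδ0 : 0 ≤ δ) (hδ1 : δ ≤ 1)
    (hM : 0 < M) (X : Fin M → Fin n → Bool)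
    (hX : Pairwise fun i j => K ≤ hammingDist (X i) (X j)) :
    ∃ D : (Fin n → Bool) → Fin M, ∀ (i : Fin M) (p : Fin n → Bool → ℝ),
      (∀ j t, 0 ≤ p j t) → (∀ j, ∑ t, p j t = 1) →
      (∀ j, δ ≤ bitSign (X i j) * (p j true - c)) →
      1 - M * (1 - δ ^ 2 / 4) ^ K ≤ ∑ y with D y = i, ∏ j, p j (y j) := by
  have : Nonempty (Fin M) := ⟨⟨0, hM⟩⟩
  choose D hD using fun y => Finite.exists_max fun i => score c (X i) y
  refine ⟨D, fun i p hp hp1 hmean => ?_⟩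
  have hθ0 : 0 ≤ 1 - δ ^ 2 / 4 := by nlinarith
  have hθ1 : 1 - δ ^ 2 / 4 ≤ 1 := by nlinarith
  have htot : ∑ y : Fin n → Bool, ∏ j, p j (y j) = 1 := by
    have := Finset.prod_univ_sum (fun _ : Fin n => (Finset.univ : Finset Bool)) p
    rw [Fintype.piFinset_univ] at this
    rw [← this]
    exact Finset.prod_eq_one fun j _ => hp1 j
  rw [← Finset.sum_filter_add_sum_filter_not _ (fun y => D y = i)] at htot
  suffices h : ∑ y with ¬ D y = i, ∏ j, p j (y j) ≤ M * (1 - δ ^ 2 / 4) ^ K by linarith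
  have hP : ∀ y : Fin n → Bool, 0 ≤ ∏ j, p j (y j) := fun y => Finset.prod_nonneg fun j _ => hp j _
  calc ∑ y with ¬ D y = i, ∏ j, p j (y j)
      ≤ ∑ y : Fin n → Bool, ∑ i' ∈ Finset.univ.erase i,
          (if score c (X i) y ≤ score c (X i') y then ∏ j, p j (y j) else 0) := by
        rw [Finset.sum_filter]
        refine Finset.sum_le_sum fun y _ => ?_
        have hnn : ∀ i' ∈ Finset.univ.erase i,
            0 ≤ if score c (X i) y ≤ score c (X i') y then ∏ j, p j (y j) else 0 := by
          intro i' _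
          split_ifs
          exacts [hP y, le_rfl]
        split_ifs with h
        · exact Finset.sum_nonneg hnn
        · refine le_trans ?_ (Finset.single_le_sum hnn
            (Finset.mem_erase.2 ⟨h, Finset.mem_univ (D y)⟩))
          rw [if_pos (hD y i)]
    _ = ∑ i' ∈ Finset.univ.erase i, ∑ y : Fin n → Bool,
          (if score c (X i) y ≤ score c (X i') y then ∏ j, p j (y j) else 0) := Finset.sum_comm
    _ ≤ ∑ i' ∈ Finset.univ.erase i, (1 - δ ^ 2 / 4) ^ K := by
        refine Finset.sum_le_sum fun i' hi' => ?_
        refine (sum_score_le_score_le hc0 hc1 hδ0 hδ1 (X i) (X i') hp hp1 hmean).trans ?_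
        exact pow_le_pow_of_le_one hθ0 hθ1 (hX (Finset.ne_of_mem_erase hi').symm)
    _ ≤ M * (1 - δ ^ 2 / 4) ^ K := by
        rw [Finset.sum_const, nsmul_eq_mul]
        refine mul_le_mul_of_nonneg_right ?_ (pow_nonneg hθ0 K)
        exact_mod_cast (Finset.card_le_univ _).trans_eq (Fintype.card_fin M)

/-! ### Separating two sets of states by a binary measurement -/

section Separation

variable {n : Type*} [Fintype n]

/-- On Hermitian matrices, every real linear functional is the trace pairing with a Hermitian
matrix: represent the complexified functional by a matrix and take its Hermitian part. -/
theorem exists_isHermitian_trace_mul_eq [DecidableEq n] (f : Module.Dual ℝ (Matrix n n ℂ)) :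
    ∃ A : Matrix n n ℂ, A.IsHermitian ∧ ∀ X : Matrix n n ℂ, X.IsHermitian →
      f X = (X * A).trace.re := by
  set g : Module.Dual ℂ (Matrix n n ℂ) := Module.Dual.extendRCLike f with hg
  set B : Matrix n n ℂ := Matrix.of fun j i => g (Matrix.single i j 1) with hB
  have hgB : ∀ X, g X = (X * B).trace := by
    intro X
    conv_lhs => rw [Matrix.matrix_eq_sum_single X]
    simp only [map_sum, Matrix.trace, Matrix.diag_apply, Matrix.mul_apply, hB, Matrix.of_apply]
    refine Finset.sum_congr rfl fun i _ => Finset.sum_congr rfl fun j _ => ?_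
    have : Matrix.single i j (X i j) = X i j • Matrix.single i j (1 : ℂ) := by simp
    rw [this, map_smul, smul_eq_mul]
  have hf : ∀ X, f X = (X * B).trace.re := by
    intro X
    rw [← hgB, hg]
    exact (Module.Dual.re_extendRCLike_apply (𝕜 := ℂ) f X).symm
  refine ⟨(2⁻¹ : ℝ) • (B + B.conjTranspose), ?_, fun X hX => ?_⟩
  · exact (Matrix.isHermitian_add_transpose_self B).smul (IsSelfAdjoint.all _)
  · have h : (X * B.conjTranspose).trace.re = (X * B).trace.re := by
      have : X * B.conjTranspose = (B * X).conjTranspose := by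
        rw [Matrix.conjTranspose_mul, hX.eq]
      rw [this, Matrix.trace_conjTranspose, Matrix.trace_mul_comm B X]
      exact Complex.conj_re _
    rw [Matrix.mul_smul, Matrix.trace_smul, Complex.smul_re, mul_add, Matrix.trace_add,
      Complex.add_re, h, hf]
    simp
    ring

/-- Two finite sets of states with disjoint convex hulls are separated by an effect. A separating
functional is represented by a Hermitian operator, and an affine rescaling brings its spectrum into
the unit interval. -/
theorem exists_effect_of_disjoint_convexHull [DecidableEq n] {U V : Set (Matrix n n ℂ)}
    (hU : U.Finite) (hV : V.Finite) (hUs : ∀ X ∈ U, IsState X) (hVs : ∀ X ∈ V, IsState X)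
    (hdisj : Disjoint (convexHull ℝ U) (convexHull ℝ V)) :
    ∃ (A : Matrix n n ℂ) (c δ : ℝ), A.PosSemidef ∧ (1 - A).PosSemidef ∧ 0 ≤ c ∧ c ≤ 1 ∧ 0 < δ ∧
      δ ≤ 1 ∧ (∀ X ∈ U, c + δ ≤ (X * A).trace.re) ∧ ∀ X ∈ V, (X * A).trace.re ≤ c - δ := by
  obtain ⟨f, u, v, hfV, huv, hfU⟩ := geometric_hahn_banach_compact_closed (convex_convexHull ℝ V)
    (hV.isCompact_convexHull ℝ) (convex_convexHull ℝ U) (hU.isClosed_convexHull ℝ) hdisj.symm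
  obtain ⟨H, hH, hfH⟩ := exists_isHermitian_trace_mul_eq (f : Matrix n n ℂ →ₗ[ℝ] ℝ)
  -- `κ` bounds `H`, `u` and `v`, so `x ↦ (2 * κ)⁻¹ * x + 2⁻¹` takes all three into the unit
  -- interval.
  set κ : ℝ := ‖H‖ + |u| + |v| + 1 with hκ
  have hκ0 : 0 < κ := by positivity
  have hHκ : ‖H‖ ≤ κ := by
    have := abs_nonneg u
    have := abs_nonneg v
    linarith
  have hκ1 : algebraMap ℝ (Matrix n n ℂ) ‖H‖ ≤ algebraMap ℝ (Matrix n n ℂ) κ :=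
    algebraMap_mono _ hHκ
  have hsa : IsSelfAdjoint H := hH
  have hup : H ≤ algebraMap ℝ (Matrix n n ℂ) κ := hsa.le_algebraMap_norm_self.trans hκ1
  have hlow : -algebraMap ℝ (Matrix n n ℂ) κ ≤ H :=
    (neg_le_neg hκ1).trans hsa.neg_algebraMap_norm_le_self
  have hκinv : 0 ≤ (2 * κ)⁻¹ := by positivity
  have hκhalf : (2 * κ)⁻¹ * κ = 2⁻¹ := by field_simp
  set A : Matrix n n ℂ := (2 * κ)⁻¹ • (H + algebraMap ℝ (Matrix n n ℂ) κ) with hA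
  have hsum : (2 * κ)⁻¹ • (algebraMap ℝ (Matrix n n ℂ) κ - H) = 1 - A := by
    have h1 : (2 * κ)⁻¹ • algebraMap ℝ (Matrix n n ℂ) κ = (2⁻¹ : ℝ) • (1 : Matrix n n ℂ) := by
      rw [Algebra.algebraMap_eq_smul_one, smul_smul, hκhalf]
    have h2 : (1 : Matrix n n ℂ) = (2⁻¹ : ℝ) • (1 : Matrix n n ℂ) + (2⁻¹ : ℝ) • 1 := by
      rw [← add_smul]
      norm_num
    rw [hA, smul_sub, smul_add, h1]
    nth_rewrite 2 [h2]
    abel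
  have htr : ∀ X, IsState X → (X * A).trace.re = (2 * κ)⁻¹ * f X + 2⁻¹ := by
    intro X hX
    have hfX : f X = (X * H).trace.re := hfH X hX.1.isHermitian
    rw [hfX, hA, Matrix.mul_smul, Matrix.trace_smul, Complex.smul_re, mul_add X, Matrix.trace_add,
      Complex.add_re, Algebra.algebraMap_eq_smul_one, Matrix.mul_smul, mul_one, Matrix.trace_smul,
      hX.2, Complex.smul_re, Complex.one_re, smul_eq_mul, smul_eq_mul, mul_one, mul_add, hκhalf]
  have hu := abs_le.1 (show |u| ≤ κ by
    have := abs_nonneg v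
    have := norm_nonneg H
    linarith)
  have hv := abs_le.1 (show |v| ≤ κ by
    have := abs_nonneg u
    have := norm_nonneg H
    linarith)
  have huκ : -2⁻¹ ≤ (2 * κ)⁻¹ * u ∧ (2 * κ)⁻¹ * u ≤ 2⁻¹ := by
    rw [← hκhalf, ← mul_neg]
    exact ⟨mul_le_mul_of_nonneg_left hu.1 hκinv, mul_le_mul_of_nonneg_left hu.2 hκinv⟩
  have hvκ : -2⁻¹ ≤ (2 * κ)⁻¹ * v ∧ (2 * κ)⁻¹ * v ≤ 2⁻¹ := by
    rw [← hκhalf, ← mul_neg]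
    exact ⟨mul_le_mul_of_nonneg_left hv.1 hκinv, mul_le_mul_of_nonneg_left hv.2 hκinv⟩
  have huvκ : (2 * κ)⁻¹ * u < (2 * κ)⁻¹ * v := mul_lt_mul_of_pos_left huv (by positivity)
  refine ⟨A, ((2 * κ)⁻¹ * u + (2 * κ)⁻¹ * v) / 2 + 2⁻¹,
    ((2 * κ)⁻¹ * v - (2 * κ)⁻¹ * u) / 2, ?_, ?_, by linarith [huκ.1, hvκ.1],
    by linarith [huκ.2, hvκ.2], by linarith, by linarith [huκ.1, hvκ.2],
    fun X hX => ?_, fun X hX => ?_⟩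
  · refine Matrix.nonneg_iff_posSemidef.1 (smul_nonneg hκinv ?_)
    rw [← sub_neg_eq_add]
    exact sub_nonneg.2 hlow
  · rw [← hsum]
    exact Matrix.nonneg_iff_posSemidef.1 (smul_nonneg hκinv (sub_nonneg.2 hup))
  · rw [htr X (hUs X hX)]
    have := mul_le_mul_of_nonneg_left (hfU X (subset_convexHull ℝ U hX)).le hκinv
    linarith
  · rw [htr X (hVs X hX)]
    have := mul_le_mul_of_nonneg_left (hfV X (subset_convexHull ℝ V hX)).le hκinv
    linarith

end Separation

/-! ### Codes -/

section Code

variable {a b S : Type*} [Fintype a] [DecidableEq a] [Fintype b] [DecidableEq b]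

theorem MessageCode.sum_success {l M : ℕ} (C : MessageCode a b l M) (N : S → Channel a b)
    (s : Fin l → S) (i : Fin M) :
    ∑ j, (blockMap N s (C.state i) * C.effect j).trace.re = 1 := by
  rw [← Complex.re_sum, ← Matrix.trace_sum, ← Finset.mul_sum, C.sum_effect, mul_one,
    (isState_blockMap N s (C.isState_state i)).2, Complex.one_re]

theorem MessageCode.success_nonneg {l M : ℕ} (C : MessageCode a b l M) (N : S → Channel a b)
    (s : Fin l → S) (i j : Fin M) : 0 ≤ (blockMap N s (C.state i) * C.effect j).trace.re :=
  (Complex.nonneg_iff.1 (trace_mul_nonneg (isState_blockMap N s (C.isState_state i)).1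
    (C.posSemidef_effect j))).1

theorem MessageCode.maxError_nonneg {l M : ℕ} (C : MessageCode a b l M) (N : S → Channel a b) :
    0 ≤ C.maxError N := by
  refine Real.iSup_nonneg fun s => Real.iSup_nonneg fun i => ?_
  rw [← C.sum_success N s i]
  exact sub_nonneg.2 (Finset.single_le_sum (f := fun j =>
    (blockMap N s (C.state i) * C.effect j).trace.re)
    (fun j _ => C.success_nonneg N s i j) (Finset.mem_univ i))

theorem MessageCode.maxError_le {l M : ℕ} (C : MessageCode a b l M) (N : S → Channel a b) {ε : ℝ}
    (hε : 0 ≤ ε)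
    (h : ∀ s i, 1 - ε ≤ (blockMap N s (C.state i) * C.effect i).trace.re) :
    C.maxError N ≤ ε :=
  Real.iSup_le (fun s => Real.iSup_le (fun i => by linarith [h s i]) hε) hε

theorem MessageCode.one_sub_maxError_le [Finite S] {l M : ℕ} (C : MessageCode a b l M)
    (N : S → Channel a b) (s : Fin l → S) (i : Fin M) :
    1 - C.maxError N ≤ (blockMap N s (C.state i) * C.effect i).trace.re := by
  have h1 : 1 - (blockMap N s (C.state i) * C.effect i).trace.re ≤ C.errorAt N s :=
    le_ciSup (f := fun i => 1 - (blockMap N s (C.state i) * C.effect i).trace.re)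
      (Set.finite_range _).bddAbove i
  have h2 : C.errorAt N s ≤ C.maxError N := le_ciSup (Set.finite_range _).bddAbove s
  linarith

/-- Two messages whose sets of possible outputs have intersecting convex hulls cannot both be
decoded with probability more than one half: the success probabilities are affine in the output, and
at a common point of the hulls they add up to at most one. -/
theorem MessageCode.half_le_maxError [Finite S] {l M : ℕ} (C : MessageCode a b l M)
    (N : S → Channel a b) {i j : Fin M} (hij : i ≠ j)
    (h : (convexHull ℝ (Set.range fun s : Fin l → S => blockMap N s (C.state i)) ∩
      convexHull ℝ (Set.range fun s : Fin l → S => blockMap N s (C.state j))).Nonempty) :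
    1 / 2 ≤ C.maxError N := by
  obtain ⟨X, hXi, hXj⟩ := h
  let T : Fin M → Matrix (Fin l → b) (Fin l → b) ℂ →ₗ[ℝ] ℝ := fun i' =>
    { toFun := fun X => (X * C.effect i').trace.re
      map_add' := fun X Y => by rw [add_mul, Matrix.trace_add, Complex.add_re]
      map_smul' := fun t X => by
        rw [Matrix.smul_mul, Matrix.trace_smul, Complex.smul_re]; rfl }
  have hi : X ∈ {X | 1 - C.maxError N ≤ T i X} := by
    refine convexHull_min ?_ (convex_halfSpace_ge (T i).isLinear _) hXi
    rintro _ ⟨s, rfl⟩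
    exact C.one_sub_maxError_le N s i
  have hj : X ∈ {X | 1 - C.maxError N ≤ T j X} := by
    refine convexHull_min ?_ (convex_halfSpace_ge (T j).isLinear _) hXj
    rintro _ ⟨s, rfl⟩
    exact C.one_sub_maxError_le N s j
  have hsum : X ∈ {X | (T i + T j) X ≤ 1} := by
    refine convexHull_min ?_ (convex_halfSpace_le (T i + T j).isLinear _) hXi
    rintro _ ⟨s, rfl⟩
    change (blockMap N s (C.state i) * C.effect i).trace.re +
      (blockMap N s (C.state i) * C.effect j).trace.re ≤ 1
    rw [← C.sum_success N s i, ← Finset.sum_pair hij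
      (f := fun j => (blockMap N s (C.state i) * C.effect j).trace.re)]
    exact Finset.sum_le_sum_of_subset_of_nonneg (Finset.subset_univ _) fun j _ _ =>
      C.success_nonneg N s i j
  simp only [Set.mem_ofPred_eq, LinearMap.add_apply] at hi hj hsum
  linarith

/-- Binary codewords, written blockwise with the states `ρ true` and `ρ false`, together with a
blockwise measurement of the effect `A` and maximum-score decoding, form a code for the block
channels. -/
theorem exists_messageCode (N : S → Channel a b) {l : ℕ}
    {ρ : Bool → Matrix (Fin l → a) (Fin l → a) ℂ} (hρ : ∀ t, IsState (ρ t))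
    {A : Matrix (Fin l → b) (Fin l → b) ℂ} (hA : A.PosSemidef) (hA1 : (1 - A).PosSemidef)
    {c δ : ℝ} (hc0 : 0 ≤ c) (hc1 : c ≤ 1) (hδ0 : 0 ≤ δ) (hδ1 : δ ≤ 1)
    (hsep : ∀ (s : Fin l → S) t, δ ≤ bitSign t * ((blockMap N s (ρ t) * A).trace.re - c))
    {n r m M K : ℕ} (σ : (Fin n × Fin l) ⊕ Fin r ≃ Fin m) (hM : 0 < M) (X : Fin M → Fin n → Bool)
    (hX : Pairwise fun i j => K ≤ hammingDist (X i) (X j))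
    {Q : Matrix (Fin r → a) (Fin r → a) ℂ} (hQ : IsState Q) :
    ∃ C : MessageCode a b m M, ∀ s i,
      1 - M * (1 - δ ^ 2 / 4) ^ K ≤ (blockMap N s (C.state i) * C.effect i).trace.re := by
  obtain ⟨D, hD⟩ := exists_decoder hc0 hc1 hδ0 hδ1 hM X hX
  -- The two-outcome measurement in one block; the outcome `true` is the effect `A`.
  let E : Bool → Matrix (Fin l → b) (Fin l → b) ℂ := fun t => if t then A else 1 - A
  have hE : ∀ t, (E t).PosSemidef := fun t => by cases t <;> simpa [E]
  have hE1 : ∑ t, E t = 1 := by simp [E]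
  refine ⟨
    { state := fun i => blockOp σ (fun x => ρ (X i x)) Q
      isState_state := fun i => isState_blockOp σ (fun x => hρ _) hQ
      effect := fun i => ∑ y with D y = i, blockOp σ (fun x => E (y x)) 1
      posSemidef_effect := fun i => Matrix.posSemidef_sum _ fun y _ =>
        posSemidef_blockOp σ (fun x => hE _) Matrix.PosSemidef.one
      sum_effect := by
        rw [Finset.sum_fiberwise]
        exact sum_blockOp σ E hE1 }, fun s i => ?_⟩
  set p : Fin n → Bool → ℝ := fun x t =>
    (blockMap N ((blockEquiv S σ s).1 x) (ρ (X i x)) * E t).trace.re with hp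
  have hst : ∀ x, IsState (blockMap N ((blockEquiv S σ s).1 x) (ρ (X i x))) := fun x =>
    isState_blockMap N _ (hρ _)
  have hpC : ∀ x t,
      (blockMap N ((blockEquiv S σ s).1 x) (ρ (X i x)) * E t).trace = (p x t : ℂ) := fun x t =>
    Complex.ext rfl (Complex.nonneg_iff.1 (trace_mul_nonneg (hst x).1 (hE t))).2.symm
  have htrace : (blockMap N s (blockOp σ (fun x => ρ (X i x)) Q) *
      ∑ y with D y = i, blockOp σ (fun x => E (y x)) 1).trace.re =
        ∑ y with D y = i, ∏ x, p x (y x) := by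
    rw [Finset.mul_sum, Matrix.trace_sum, Complex.re_sum]
    refine Finset.sum_congr rfl fun y _ => ?_
    rw [blockMap_blockOp, blockOp_mul, trace_blockOp, mul_one, (isState_blockMap N _ hQ).2, mul_one]
    simp only [hpC]
    rw [← Complex.ofReal_prod, Complex.ofReal_re]
  change _ ≤ (blockMap N s (blockOp σ (fun x => ρ (X i x)) Q) *
      ∑ y with D y = i, blockOp σ (fun x => E (y x)) 1).trace.re
  rw [htrace]
  refine hD i p (fun x t =>
    (Complex.nonneg_iff.1 (trace_mul_nonneg (hst x).1 (hE t))).1) (fun x => ?_)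
    fun x => hsep _ _
  rw [hp, ← Complex.re_sum, ← Matrix.trace_sum, ← Finset.mul_sum, hE1, mul_one, (hst x).2,
    Complex.one_re]

theorem isState_single {n : Type*} [Fintype n] [DecidableEq n] (i : n) :
    IsState (Matrix.single i i (1 : ℂ)) := by
  refine ⟨?_, Matrix.trace_single_eq_same i 1⟩
  have : Matrix.single i i (1 : ℂ) = (Matrix.single i i 1).conjTranspose * Matrix.single i i 1 := by
    simp
  rw [this]
  exact Matrix.posSemidef_conjTranspose_mul_self _

/-- If the outputs of two states of some block length are separated by a binary measurement, then a
positive rate is achievable. For block length `m`, the rate is that of the codes of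
`exists_binary_code`, lowered by a constant factor `g` for which `2 ^ k` messages do not outweigh
the error exponent of the minimum distance `g * k`. -/
theorem exists_isAchievableRate_pos (N : S → Channel a b) {l : ℕ} (hl : 0 < l)
    {ρ : Bool → Matrix (Fin l → a) (Fin l → a) ℂ} (hρ : ∀ t, IsState (ρ t))
    {A : Matrix (Fin l → b) (Fin l → b) ℂ} (hA : A.PosSemidef) (hA1 : (1 - A).PosSemidef)
    {c δ : ℝ} (hc0 : 0 ≤ c) (hc1 : c ≤ 1) (hδ0 : 0 < δ) (hδ1 : δ ≤ 1)
    (hsep : ∀ (s : Fin l → S) t, δ ≤ bitSign t * ((blockMap N s (ρ t) * A).trace.re - c)) :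
    ∃ R : ℝ≥0, 0 < R ∧ IsAchievableRate N R := by
  have ha : Nonempty a := by
    by_contra hne
    have : IsEmpty a := not_nonempty_iff.1 hne
    have : IsEmpty (Fin l → a) := ⟨fun f => isEmptyElim (f ⟨0, hl⟩)⟩
    have := (hρ true).2
    simp [Matrix.trace] at this
  obtain ⟨i₀⟩ := ha
  have hθ0 : 0 ≤ 1 - δ ^ 2 / 4 := by nlinarith
  have hθ1 : 1 - δ ^ 2 / 4 < 1 := by nlinarith
  obtain ⟨g, hg⟩ : ∃ g : ℕ, (1 - δ ^ 2 / 4) ^ g < 1 / 4 :=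
    exists_pow_lt_of_lt_one (by norm_num) hθ1
  have hg0 : 0 < g := by
    rcases g.eq_zero_or_pos with rfl | h
    · norm_num at hg
    · exact h
  -- With `k = m / L` there are `2 ^ k` messages, encoded in binary words of length `5 * (g * k)`
  -- and minimum distance `g * k`. Each letter takes `l` positions; `m % L` positions carry a fixed
  -- state.
  set L : ℕ := 5 * g * l with hL
  have hL0 : 0 < L := by positivity
  have hcode : ∀ m : ℕ, ∃ C : MessageCode a b m (2 ^ (m / L)),
      C.maxError N ≤ (1 / 2) ^ (m / L) := by
    intro m
    obtain ⟨X, hX⟩ := exists_binary_code (k := g * (m / L)) (M := 2 ^ (m / L))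
      (Nat.pow_le_pow_right two_pos (Nat.le_mul_of_pos_left _ hg0))
    have hm : 5 * (g * (m / L)) * l + m % L = m := by
      conv_rhs => rw [← Nat.div_add_mod m L]
      rw [hL]
      ring
    obtain ⟨C, hC⟩ := exists_messageCode N hρ hA hA1 hc0 hc1 hδ0.le hδ1 hsep
      (((finProdFinEquiv.sumCongr (Equiv.refl _)).trans finSumFinEquiv).trans (finCongr hm))
      (by positivity) X hX (isState_single fun _ => i₀)
    refine ⟨C, C.maxError_le N (by positivity) fun s i => le_trans ?_ (hC s i)⟩
    have : ((2 ^ (m / L) : ℕ) : ℝ) * (1 - δ ^ 2 / 4) ^ (g * (m / L)) ≤ (1 / 2) ^ (m / L) := by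
      rw [pow_mul, Nat.cast_pow, Nat.cast_ofNat, ← mul_pow]
      refine pow_le_pow_left₀ (by positivity) ?_ _
      linarith
    linarith
  choose C hC using hcode
  refine ⟨1 / (2 * L), by positivity, fun m => 2 ^ (m / L), C, fun m => by positivity, ?_, ?_⟩
  · refine le_liminf_of_le (by isBoundedDefault) ?_
    filter_upwards [eventually_ge_atTop L] with m hm
    have h1 : 1 ≤ m / L := (Nat.one_le_div_iff hL0).2 hm
    have h2 : m ≤ m / L * (2 * L) := by
      have h3 := Nat.lt_div_mul_add hL0 (a := m)
      nlinarith
    rw [EReal.coe_le_coe_iff]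
    push_cast
    rw [Real.logb_pow, Real.logb_self_eq_one one_lt_two, mul_one, one_div_mul_eq_div,
      div_le_div_iff₀ (by positivity) (by exact_mod_cast hL0.trans_le hm), one_mul]
    exact_mod_cast h2
  · refine squeeze_zero (fun m => (C m).maxError_nonneg N) hC ?_
    exact (tendsto_pow_atTop_nhds_zero_of_lt_one (by norm_num) (by norm_num)).comp
      (Nat.tendsto_div_const_atTop hL0.ne')

end Code

end AVQC

theorem mainTheorem4 {a b S : Type*} [Fintype a] [DecidableEq a] [Fintype b] [DecidableEq b]
    [Finite S] (N : S → AVQC.Channel a b) :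
    AVQC.detMaxCapacity N = 0 ↔
      ∀ l : ℕ, 0 < l → ∀ ρ₁ ρ₂ : Matrix (Fin l → a) (Fin l → a) ℂ,
        AVQC.IsState ρ₁ → AVQC.IsState ρ₂ →
          (convexHull ℝ (Set.range fun s : Fin l → S => AVQC.blockMap N s ρ₁) ∩
            convexHull ℝ (Set.range fun s : Fin l → S => AVQC.blockMap N s ρ₂)).Nonempty := by
  constructor
  · intro hcap l hl ρ₁ ρ₂ h₁ h₂
    by_contra hne
    have hdisj := Set.disjoint_iff_inter_eq_empty.2 (Set.not_nonempty_iff_eq_empty.1 hne)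
    obtain ⟨A, c, δ, hA, hA1, hc0, hc1, hδ0, hδ1, hsep₁, hsep₂⟩ :=
      AVQC.exists_effect_of_disjoint_convexHull (Set.finite_range _) (Set.finite_range _)
        (by rintro _ ⟨s, rfl⟩; exact AVQC.isState_blockMap N s h₁)
        (by rintro _ ⟨s, rfl⟩; exact AVQC.isState_blockMap N s h₂) hdisj
    obtain ⟨R, hR, hach⟩ := AVQC.exists_isAchievableRate_pos N hl
      (ρ := fun t => if t then ρ₁ else ρ₂) (fun t => by cases t <;> simpa) hA hA1 hc0 hc1 hδ0 hδ1
      (fun s t => by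
        cases t
        · have := hsep₂ _ ⟨s, rfl⟩
          simp only [AVQC.bitSign, Bool.false_eq_true, if_false]
          linarith
        · have := hsep₁ _ ⟨s, rfl⟩
          simp only [AVQC.bitSign, if_true]
          linarith)
    have hle : (R : ℝ≥0∞) ≤ AVQC.detMaxCapacity N :=
      le_iSup₂ (f := fun (R : ℝ≥0) (_ : AVQC.IsAchievableRate N R) => (R : ℝ≥0∞)) R hach
    rw [hcap, nonpos_iff_eq_zero, ENNReal.coe_eq_zero] at hle
    exact hR.ne' hle
  · intro hsymm
    refine le_antisymm (iSup₂_le ?_) zero_le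
    rintro R ⟨M, C, hM, hrate, herr⟩
    by_contra hR
    have hR0 : 0 < R := by
      rw [nonpos_iff_eq_zero, ENNReal.coe_eq_zero] at hR
      exact pos_iff_ne_zero.2 hR
    have hlim := lt_of_lt_of_le (show (0 : EReal) < ((R : ℝ) : EReal) by exact_mod_cast hR0) hrate
    obtain ⟨l, hl, hlog, hsmall⟩ := ((eventually_gt_atTop 0).and
      ((eventually_lt_of_lt_liminf hlim (by isBoundedDefault)).and
        (herr.eventually_lt_const (show (0 : ℝ) < 1 / 2 by norm_num)))).exists
    -- A single message has rate `0`, so a positive rate forces two distinct messages.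
    have hM2 : 1 < M l := by
      by_contra hle
      have h1 : M l = 1 := le_antisymm (not_lt.1 hle) (hM l)
      rw [h1] at hlog
      simp at hlog
    have hij : (⟨0, hM l⟩ : Fin (M l)) ≠ ⟨1, hM2⟩ := by simp
    exact absurd ((C l).half_le_maxError N hij
      (hsymm l hl _ _ ((C l).isState_state _) ((C l).isState_state _))) (not_le.2 hsmall)
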